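/- Let $\mathscr P$ be the set of all integer partitions; for $\lambda\in\mathscr P$ write $|\lambda|$ for its size and $r_m(\lambda)$ for the number of parts of $\lambda$ equal to $m$. For $f:\mathscr P\to\mathbb Q$ let $$\langle f\rangle_q=\frac{\sum_{\lambda\in\mathscr P}f(\lambda)q^{|\lambda|}}{\sum_{\lambda\in\mathscr P}q^{|\lambda|}}\in\mathbb Q[[q]].$$ Let $\mathbb P\subset\mathbb Q^{\mathscr P}$ be the image of the linear map $\Psi:\bigoplus_{n\ge 0}\mathbb Q[x_1,\dots,x_n,y_1,\dots,y_n]\to\mathbb Q^{\mathscr P}$ sending $p(x_1,\dots,x_n,y_1,\dots,y_n)$ to $$\lambda\mapsto\sum_{m_1>\dots>m_n>0}\ \sum_{r_1=1}^{r_{m_1}(\lambda)}\cdots\sum_{r_n=1}^{r_{m_n}(\lambda)}p(m_1,\dots,m_n,r_1,\dots,r_n).$$ For even $k\ge 2$ let $G_k=-\frac{B_k}{2\,k!}+\frac1{(k-1)!}\sum_{m,r\ge1}m^{k-1}q^{mr}\in\mathbb Q[[q]]$, where $B_k$ is the $k$-th Bernoulli number; let $\widetilde M=\mathbb Q[G_k\mid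 k\ge 2 \text{ even}]\subset\mathbb Q[[q]]$ be the ring of quasimodular forms (of mixed weight), and let $\mathbb M=\{f\in\mathbb P\mid\langle f\rangle_q\in\widetilde M\}$. For $k\ge1$ let $f_k\in\mathbb Q[x]$ be the Bernoulli–Seki polynomial, i.e. the unique polynomial with $f_k(x)-f_k(x-1)=\frac{x^{k-1}}{(k-1)!}$ and $f_k(0)=0$. For $k\ge 1$ and $d,n\ge0$ let $P_{\mathrm s}\binom{k,\dots,k}{d,\dots,d}$ (with $n$ columns) be the function on partitions $$\lambda\mapsto\sum_{m_1>\dots>m_n>0}\ \prod_{j=1}^n m_j^{d}\,f_k(r_{m_j}(\lambda)),$$ which is the constant function $1$ if $n=0$. Proposition. Let $k\ge2$ and $d\ge0$ be integers with $k+d$ even, and let $n\ge0$. Then $P_{\mathrm s}\binom{k,\dots,k}{d,\dots,d}\in\mathbb M$ (with $n$ columns). Moreover its $q$-bracket is a polynomial with rational coefficients in the series $\bigl(q\frac{d}{dq}\bigr)^aG_{k'}$ with $a\ge0$ and $k'\ge2$ even; in particular it is a quasimodular form of mixed weight. -/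

import Mathlib

noncomputable section

namespace PartitionMZV

open Polynomial

/-- The set of all partitions of all non-negative integers. -/
abbrev AllPartitions : Type := Σ N : ℕ, Nat.Partition N

/-- `mult lam m` is the number of times that `m` occurs as a part of the partition `lam`. -/
def mult (lam : AllPartitions) (m : ℕ) : ℕ := lam.2.parts.count m

/-- The power series `∑ f(lam) q ^ |lam|`, the sum being over all partitions `lam`. -/
def partitionSeries (f : AllPartitions → ℚ) : PowerSeries ℚ :=
  PowerSeries.mk fun N => ∑ lam : Nat.Partition N, f ⟨N, lam⟩

/-- The `q`-bracket `(∑ f(lam) q ^ |lam|) / (∑ q ^ |lam|)`. The denominator has constant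
coefficient `1`, so its inverse in the ring of power series exists. -/
def qBracket (f : AllPartitions → ℚ) : PowerSeries ℚ :=
  partitionSeries f * (partitionSeries fun _ => 1)⁻¹

/-- The strictly decreasing sequences `m_1 > ... > m_n > 0` of positive integers. -/
abbrev DecSeq (n : ℕ) : Type := {m : Fin n → ℕ // StrictAnti m ∧ ∀ j, 0 < m j}

/-- Only finitely many decreasing sequences consist of parts of a given partition. -/
theorem finite_setOf_mult_pos (lam : AllPartitions) (n : ℕ) :
    {m : DecSeq n | ∀ j, 0 < mult lam (m.1 j)}.Finite := by
  have h : (Set.pi Set.univ fun _ : Fin n => {i : ℕ | i ∈ lam.2.parts.toFinset}).Finite :=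
    Set.Finite.pi fun _ => Finset.finite_toSet _
  refine Set.Finite.of_finite_image (f := Subtype.val) (h.subset ?_)
    Subtype.val_injective.injOn
  rintro _ ⟨m, hm, rfl⟩ j -
  have hj := hm j
  simp only [mult, Multiset.count_pos] at hj
  simpa using hj

/-- The inner sum
`∑_{r_1 = 1}^{r_{m_1}(lam)} ... ∑_{r_n = 1}^{r_{m_n}(lam)} p(m_1, ..., m_n, r_1, ..., r_n)`;
the variable `Sum.inl j` is `x_j`, the variable `Sum.inr j` is `y_j`. -/
def psiTerm {n : ℕ} (p : MvPolynomial (Fin n ⊕ Fin n) ℚ) (lam : AllPartitions)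
    (m : Fin n → ℕ) : ℚ :=
  ∑ r ∈ Fintype.piFinset fun j => Finset.Icc 1 (mult lam (m j)),
    MvPolynomial.eval (Sum.elim (fun j => (m j : ℚ)) (fun j => (r j : ℚ))) p

theorem finite_support_psiTerm {n : ℕ} (p : MvPolynomial (Fin n ⊕ Fin n) ℚ)
    (lam : AllPartitions) :
    (Function.support fun m : DecSeq n => psiTerm p lam m.1).Finite := by
  refine (finite_setOf_mult_pos lam n).subset fun m hm j => ?_
  by_contra h
  refine hm ?_
  have h0 : mult lam (m.1 j) = 0 := by omega
  have he : (Fintype.piFinset fun j => Finset.Icc 1 (mult lam (m.1 j))) = ∅ := by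
    refine Finset.eq_empty_of_forall_notMem fun r hr => ?_
    have hj := Finset.mem_Icc.1 (Fintype.mem_piFinset.1 hr j)
    omega
  simp [psiTerm, he]

/-- The component of `Ψ` on polynomials in `x_1, ..., x_n, y_1, ..., y_n`: the sum of `psiTerm`
over all `m_1 > ... > m_n > 0`, in which only finitely many terms are nonzero. -/
def psi (n : ℕ) : MvPolynomial (Fin n ⊕ Fin n) ℚ →ₗ[ℚ] (AllPartitions → ℚ) where
  toFun p lam := ∑ᶠ m : DecSeq n, psiTerm p lam m.1
  map_add' p p' := by
    funext lam
    have h : ∀ m : DecSeq n,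
        psiTerm (p + p') lam m.1 = psiTerm p lam m.1 + psiTerm p' lam m.1 := fun m => by
      simp [psiTerm, Finset.sum_add_distrib]
    simp only [h, Pi.add_apply]
    exact finsum_add_distrib (finite_support_psiTerm p lam) (finite_support_psiTerm p' lam)
  map_smul' c p := by
    funext lam
    have h : ∀ m : DecSeq n, psiTerm (c • p) lam m.1 = c * psiTerm p lam m.1 := fun m => by
      simp [psiTerm, Finset.mul_sum, MvPolynomial.smul_eval]
    simp only [h, Pi.smul_apply, smul_eq_mul, RingHom.id_apply]
    exact (mul_finsum' (fun m : DecSeq n => psiTerm p lam m.1) c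
      (finite_support_psiTerm p lam)).symm

open DirectSum in
/-- The map `Ψ : ⨁ n, ℚ[x_1, ..., x_n, y_1, ..., y_n] → (AllPartitions → ℚ)`. -/
def Psi : (⨁ n : ℕ, MvPolynomial (Fin n ⊕ Fin n) ℚ) →ₗ[ℚ] (AllPartitions → ℚ) :=
  DirectSum.toModule ℚ ℕ (AllPartitions → ℚ) psi

/-- The space `ℙ` of polynomial functions on partitions, the image of `Ψ`. -/
def polynomialFunctions : Submodule ℚ (AllPartitions → ℚ) := LinearMap.range Psi

/-- The Eisenstein series
`G_k = - B_k / (2 k!) + 1 / (k - 1)! * ∑_{m, r ≥ 1} m ^ (k - 1) q ^ (m r)`,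
used for even `k ≥ 2` only. The coefficient of `q ^ N` in the double sum is the sum of
`m ^ (k - 1)` over the divisors `m` of `N` (and is `0` for `N = 0`, where `Nat.divisors 0 = ∅`). -/
def eisensteinG (k : ℕ) : PowerSeries ℚ :=
  PowerSeries.C (-(_root_.bernoulli k) / (2 * (k.factorial : ℚ))) +
    PowerSeries.C (1 / ((k - 1).factorial : ℚ)) *
      PowerSeries.mk fun N => ∑ m ∈ N.divisors, (m : ℚ) ^ (k - 1)

/-- The ring `ℚ[G_2, G_4, G_6, ...]` of quasimodular forms (of mixed weight). -/
def quasimodularForms : Subalgebra ℚ (PowerSeries ℚ) :=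
  Algebra.adjoin ℚ {F | ∃ k : ℕ, 2 ≤ k ∧ Even k ∧ F = eisensteinG k}

/-- The derivation `q d/dq`. -/
def qDeriv (F : PowerSeries ℚ) : PowerSeries ℚ :=
  PowerSeries.X * PowerSeries.derivative (R := ℚ) F

/-- The ring of polynomials, with rational coefficients, in the derivatives
`(q d/dq)^a G_k` (`a ≥ 0`, `k ≥ 2` even) of Eisenstein series. -/
def eisensteinDerivativeAlgebra : Subalgebra ℚ (PowerSeries ℚ) :=
  Algebra.adjoin ℚ {F | ∃ a k : ℕ, 2 ≤ k ∧ Even k ∧ F = qDeriv^[a] (eisensteinG k)}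

/-- The space `𝕄` of polynomial functions on partitions with quasimodular `q`-bracket. -/
def quasimodularFunctions : Set (AllPartitions → ℚ) :=
  {f | f ∈ polynomialFunctions ∧ qBracket f ∈ quasimodularForms}

/-- For a polynomial sequence `F = (f_0, f_1, ...)`, the function
`P_F(k_1, ..., k_n; d_1, ..., d_n)` on partitions, that is
`lam ↦ ∑_{m_1 > ... > m_n > 0} ∏_j m_j ^ d_j * f_{k_j}(r_{m_j}(lam))`.
Only finitely many terms are nonzero if `f_{k_j}(0) = 0` for all `j`. -/
def partitionMZV (F : ℕ → ℚ[X]) {n : ℕ} (k d : Fin n → ℕ) (lam : AllPartitions) : ℚ :=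
  ∑ᶠ m : DecSeq n, ∏ j, (m.1 j : ℚ) ^ d j * (F (k j)).eval (mult lam (m.1 j) : ℚ)

/-- The Bernoulli–Seki (Faulhaber) polynomials: `f_0 = 1` and, for `k ≥ 1`,
`f_k(x) = (B_k(x + 1) - B_k(1)) / k!` with the Bernoulli polynomial `B_k`. For `k ≥ 1` this is
the unique polynomial with `f_k(x) - f_k(x - 1) = x ^ (k - 1) / (k - 1)!` and `f_k(0) = 0`:
see the next three facts. -/
def bernoulliSeki (k : ℕ) : ℚ[X] :=
  if k = 0 then 1 else
    C (1 / (k.factorial : ℚ)) *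
      ((Polynomial.bernoulli k).comp (X + 1) - C ((Polynomial.bernoulli k).eval 1))

theorem bernoulliSeki_eval_zero {k : ℕ} (hk : 1 ≤ k) : (bernoulliSeki k).eval 0 = 0 := by
  have hk0 : k ≠ 0 := by omega
  simp [bernoulliSeki, hk0]

theorem bernoulliSeki_sub {k : ℕ} (hk : 1 ≤ k) (x : ℚ) :
    (bernoulliSeki k).eval x - (bernoulliSeki k).eval (x - 1) =
      1 / ((k - 1).factorial : ℚ) * x ^ (k - 1) := by
  obtain ⟨k, rfl⟩ : ∃ l, k = l + 1 := ⟨k - 1, by omega⟩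
  have h := Polynomial.bernoulli_eval_one_add (k + 1) x
  rw [add_comm 1 x] at h
  simp only [bernoulliSeki, Nat.add_eq_zero_iff, one_ne_zero, and_false, if_false, eval_mul,
    eval_C, eval_sub, eval_comp, eval_add, eval_X, eval_one, sub_add_cancel, h,
    Nat.add_sub_cancel, Nat.factorial_succ, Nat.cast_mul]
  have h1 : ((k + 1 : ℕ) : ℚ) ≠ 0 := by positivity
  have h2 : (k.factorial : ℚ) ≠ 0 := by positivity
  field_simp
  ring

theorem eq_bernoulliSeki {k : ℕ} (hk : 1 ≤ k) (f : ℚ[X]) (h0 : f.eval 0 = 0)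
    (h : ∀ x : ℚ, f.eval x - f.eval (x - 1) = 1 / ((k - 1).factorial : ℚ) * x ^ (k - 1)) :
    f = bernoulliSeki k := by
  have key : ∀ N : ℕ, f.eval (N : ℚ) = (bernoulliSeki k).eval (N : ℚ) := by
    intro N
    induction N with
    | zero => simp [h0, bernoulliSeki_eval_zero hk]
    | succ N ih =>
      have e1 := h ((N + 1 : ℕ) : ℚ)
      have e2 := bernoulliSeki_sub hk ((N + 1 : ℕ) : ℚ)
      have e3 : ((N + 1 : ℕ) : ℚ) - 1 = N := by push_cast; ring
      rw [e3] at e1 e2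
      linarith
  refine Polynomial.eq_of_infinite_eval_eq _ _
    ((Set.infinite_range_of_injective (Nat.cast_injective (R := ℚ))).mono ?_)
  rintro _ ⟨N, rfl⟩
  exact key N

end PartitionMZV

end

noncomputable section

namespace PartitionMZV

open PowerSeries

/-! Since all columns are equal, the function is the `n`-th elementary symmetric function of the
numbers `m^d f_k(r_m(λ))`. Its generating function over partitions is therefore the coefficient of
`t^n` in the product over `m` of `∑_r (1 + t m^d f_k(r)) q^(mr)`. Write `L_l(x) = ∑ r^l x^r`. The
difference equation for `f_k` says `∑_r f_k(r) x^r = L_{k-1}(x) / ((k-1)! (1-x))`, so each factor is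
`(1 - q^m)⁻¹ (1 + t a_m)` with `a_m = m^d L_{k-1}(q^m) / (k-1)!`. Hence the `q`-bracket is the
elementary symmetric function `e_n(a_1, a_2, ...)`, and Newton's identities express it through the
power sums `∑_m a_m^j`.

These power sums are controlled by parity. For `l ≥ 1` the rational function `L_l` is symmetric or
antisymmetric under `x ↦ 1/x` according to the parity of `l`, so `L_l^j` is a combination of the
`L_i` with `i + (l+1)j` odd (`powSeries_pow_mem`). Each `L_i` contributes `∑ m^(dj) r^i q^(mr)`, and
evenness of `k + d` makes `dj + i` odd. This series is an iterated `q d/dq` of an odd-exponent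
divisor series, i.e. of an Eisenstein series up to a constant.

That the derivatives of Eisenstein series are themselves quasimodular is proved by elementary means:
Liouville's identity for `a x + b y = N` with the test function `x^(2l)` gives a Ramanujan-type
formula for `q d/dq` of a divisor series (`two_smul_qDeriv_divisorSeries`). -/

/-- The power series `∑ σ_l(N) q ^ N`. -/
def divisorSeries (l : ℕ) : PowerSeries ℚ :=
  PowerSeries.mk fun N => ∑ m ∈ N.divisors, (m : ℚ) ^ l

/-! ### Liouville's identity for `a x + b y = N`. -/

/-- The quadruples `(a, b, x, y)` of positive integers with `a * x + b * y = N`. -/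
def quads (N : ℕ) : Finset (ℕ × ℕ × ℕ × ℕ) :=
  (Finset.Icc 1 N ×ˢ Finset.Icc 1 N ×ˢ Finset.Icc 1 N ×ˢ Finset.Icc 1 N).filter
    fun t => t.1 * t.2.2.1 + t.2.1 * t.2.2.2 = N

theorem mem_quads {N a b x y : ℕ} :
    (a, b, x, y) ∈ quads N ↔ 0 < a ∧ 0 < b ∧ 0 < x ∧ 0 < y ∧ a * x + b * y = N := by
  simp only [quads, Finset.mem_filter, Finset.mem_product, Finset.mem_Icc]
  refine ⟨fun h => by omega, fun ⟨ha, hb, hx, hy, h⟩ => ?_⟩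
  have h1 := Nat.le_mul_of_pos_right a hx
  have h2 := Nat.le_mul_of_pos_right b hy
  have h3 := Nat.le_mul_of_pos_left x ha
  have h4 := Nat.le_mul_of_pos_left y hb
  omega

theorem sum_quads_swap (N : ℕ) (h : ℕ → ℕ → ℕ → ℕ → ℚ) :
    ∑ t ∈ quads N, h t.1 t.2.1 t.2.2.1 t.2.2.2 =
      ∑ t ∈ quads N, h t.2.1 t.1 t.2.2.2 t.2.2.1 := by
  refine Finset.sum_nbij' (fun t => (t.2.1, t.1, t.2.2.2, t.2.2.1))
    (fun t => (t.2.1, t.1, t.2.2.2, t.2.2.1)) ?_ ?_ ?_ ?_ ?_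
  · rintro ⟨a, b, x, y⟩ ht
    rw [mem_quads] at ht
    exact mem_quads.2 ⟨ht.2.1, ht.1, ht.2.2.2.1, ht.2.2.1, by rw [add_comm]; exact ht.2.2.2.2⟩
  · rintro ⟨a, b, x, y⟩ ht
    rw [mem_quads] at ht
    exact mem_quads.2 ⟨ht.2.1, ht.1, ht.2.2.2.1, ht.2.2.1, by rw [add_comm]; exact ht.2.2.2.2⟩
  all_goals simp

/-- The Euclidean step `a x + b y = (a + b) y + a (x - y)` exchanges the condition `x > y` for the
condition that the first coefficient exceeds the second. -/
theorem sum_quads_shear (N : ℕ) (h : ℕ → ℕ → ℚ) :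
    (∑ t ∈ quads N, if t.2.2.2 < t.2.2.1 then h t.1 t.2.1 else 0) =
      ∑ t ∈ quads N, if t.2.1 < t.1 then h t.2.1 (t.1 - t.2.1) else 0 := by
  rw [← Finset.sum_filter, ← Finset.sum_filter]
  refine Finset.sum_nbij' (fun t => (t.1 + t.2.1, t.1, t.2.2.2, t.2.2.1 - t.2.2.2))
    (fun t => (t.2.1, t.1 - t.2.1, t.2.2.1 + t.2.2.2, t.2.2.1)) ?_ ?_ ?_ ?_ ?_
  · rintro ⟨a, b, x, y⟩ ht
    rw [Finset.mem_filter, mem_quads] at ht ⊢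
    obtain ⟨⟨ha, hb, hx, hy, h⟩, hlt⟩ := ht
    dsimp only at hlt ⊢
    obtain ⟨z, rfl⟩ := Nat.exists_eq_add_of_lt hlt
    refine ⟨⟨by omega, by omega, by omega, by omega, ?_⟩, by omega⟩
    simp only [show y + z + 1 - y = z + 1 by omega]
    rw [← h]; ring
  · rintro ⟨a, b, x, y⟩ ht
    rw [Finset.mem_filter, mem_quads] at ht ⊢
    obtain ⟨⟨ha, hb, hx, hy, h⟩, hlt⟩ := ht
    dsimp only at hlt ⊢
    obtain ⟨z, rfl⟩ := Nat.exists_eq_add_of_lt hlt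
    refine ⟨⟨by omega, by omega, by omega, by omega, ?_⟩, by omega⟩
    simp only [show b + z + 1 - b = z + 1 by omega]
    rw [← h]; ring
  · rintro ⟨a, b, x, y⟩ ht
    have h := (Finset.mem_filter.1 ht).2
    simp only [Prod.mk.injEq, true_and, and_true] at h ⊢
    omega
  · rintro ⟨a, b, x, y⟩ ht
    have h := (Finset.mem_filter.1 ht).2
    simp only [Prod.mk.injEq, true_and] at h ⊢
    omega
  · rintro ⟨a, b, x, y⟩ ht
    simp

/-- If `a = b = m`, the equation is `m (x + y) = N`, which has `N / m - 1` positive solutions. -/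
theorem sum_quads_diag_left (N : ℕ) (h : ℕ → ℚ) :
    (∑ t ∈ quads N, if t.1 = t.2.1 then h t.1 else 0) =
      ∑ m ∈ N.divisors, ((N : ℚ) / m - 1) * h m := by
  have key : ∀ m ∈ N.divisors,
      ((N : ℚ) / m - 1) * h m = ∑ x ∈ Finset.Ico 1 (N / m), h m := by
    intro m hm
    obtain ⟨⟨c, rfl⟩, hN⟩ := Nat.mem_divisors.1 hm
    have hm0 : 0 < m := Nat.pos_of_mem_divisors hm
    have hc : 1 ≤ c := Nat.pos_of_ne_zero fun h => hN (by simp [h])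
    rw [Finset.sum_const, Nat.card_Ico, Nat.mul_div_cancel_left c hm0, nsmul_eq_mul]
    push_cast [hc]
    field_simp
  rw [Finset.sum_congr rfl key, ← Finset.sum_filter, Finset.sum_sigma']
  refine Finset.sum_bij' (fun t _ => (⟨t.1, t.2.2.1⟩ : Σ _ : ℕ, ℕ))
    (fun s _ => (s.1, s.1, s.2, N / s.1 - s.2)) ?_ ?_ ?_ ?_ ?_
  · rintro ⟨a, b, x, y⟩ ht
    rw [Finset.mem_filter, mem_quads] at ht
    obtain ⟨⟨ha, hb, hx, hy, h⟩, hab⟩ := ht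
    simp only at hab
    subst hab
    rw [← mul_add] at h
    subst h
    simp only [Finset.mem_sigma, Nat.mem_divisors, Finset.mem_Ico, Nat.mul_div_cancel_left _ ha]
    refine ⟨⟨Dvd.intro _ rfl, by positivity⟩, by omega, by omega⟩
  · rintro ⟨m, x⟩ hs
    simp only [Finset.mem_sigma, Finset.mem_Ico, Finset.mem_filter, mem_quads] at hs ⊢
    obtain ⟨hm, hx⟩ := hs
    have hm0 : 0 < m := Nat.pos_of_mem_divisors hm
    refine ⟨⟨hm0, hm0, by omega, by omega, ?_⟩, trivial⟩
    rw [← mul_add, Nat.add_sub_cancel' (by omega), Nat.mul_div_cancel' (Nat.dvd_of_mem_divisors hm)]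
  · rintro ⟨a, b, x, y⟩ ht
    rw [Finset.mem_filter, mem_quads] at ht
    obtain ⟨⟨ha, hb, hx, hy, h⟩, hab⟩ := ht
    simp only at hab
    subst hab
    rw [← mul_add] at h
    subst h
    simp [Nat.mul_div_cancel_left _ ha]
  · rintro ⟨m, x⟩ hs
    rfl
  · rintro ⟨a, b, x, y⟩ ht
    rfl

/-- If `x = y`, then `m = a + b` divides `N` and determines `x`, which leaves `a` free in `1, ..., m
- 1`. -/
theorem sum_quads_diag_right (N : ℕ) (h : ℕ → ℕ → ℚ) :
    (∑ t ∈ quads N, if t.2.2.1 = t.2.2.2 then h t.1 t.2.1 else 0) =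
      ∑ m ∈ N.divisors, ∑ a ∈ Finset.Ico 1 m, h a (m - a) := by
  rw [← Finset.sum_filter, Finset.sum_sigma']
  refine Finset.sum_bij' (fun t _ => (⟨t.1 + t.2.1, t.1⟩ : Σ _ : ℕ, ℕ))
    (fun s _ => (s.2, s.1 - s.2, N / s.1, N / s.1)) ?_ ?_ ?_ ?_ ?_
  · rintro ⟨a, b, x, y⟩ ht
    rw [Finset.mem_filter, mem_quads] at ht
    obtain ⟨⟨ha, hb, hx, hy, h⟩, hab⟩ := ht
    simp only at hab
    subst hab
    rw [← add_mul] at h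
    subst h
    simp only [Finset.mem_sigma, Nat.mem_divisors, Finset.mem_Ico]
    refine ⟨⟨Dvd.intro _ rfl, by positivity⟩, by omega, by omega⟩
  · rintro ⟨m, a⟩ hs
    simp only [Finset.mem_sigma, Finset.mem_Ico, Finset.mem_filter, mem_quads] at hs ⊢
    obtain ⟨hm, hx⟩ := hs
    have hc : 0 < N / m := Nat.div_pos (Nat.divisor_le hm) (Nat.pos_of_mem_divisors hm)
    refine ⟨⟨by omega, by omega, hc, hc, ?_⟩, trivial⟩
    rw [← add_mul, Nat.add_sub_cancel' (by omega), Nat.mul_div_cancel' (Nat.dvd_of_mem_divisors hm)]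
  · rintro ⟨a, b, x, y⟩ ht
    rw [Finset.mem_filter, mem_quads] at ht
    obtain ⟨⟨ha, hb, hx, hy, h⟩, hab⟩ := ht
    simp only at hab
    subst hab
    rw [← add_mul] at h
    subst h
    simp [Nat.mul_div_cancel_left _ (show 0 < a + b by omega)]
  · rintro ⟨m, a⟩ hs
    simp only [Finset.mem_sigma, Finset.mem_Ico] at hs
    simp only [Sigma.mk.injEq, heq_eq_eq, and_true]
    omega
  · rintro ⟨a, b, x, y⟩ ht
    simp

/-- Liouville's identity for the sum of `f (a - b) - f (a + b)` over `a * x + b * y = N`. -/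
theorem sum_quads_sub_add (N : ℕ) (f : ℚ → ℚ) (hf : ∀ x, f (-x) = f x) :
    ∑ t ∈ quads N, (f (t.1 - t.2.1) - f (t.1 + t.2.1)) =
      ∑ m ∈ N.divisors, ((N : ℚ) / m - 1) * (f 0 + 2 * f m) -
        ∑ m ∈ N.divisors, ∑ a ∈ Finset.Ico 1 m, (f m + 2 * f a) := by
  have right : ∀ h : ℕ → ℕ → ℚ, ∑ t ∈ quads N, h t.1 t.2.1 =
      (∑ t ∈ quads N, if t.2.2.2 < t.2.2.1 then h t.1 t.2.1 else 0) +
      (∑ t ∈ quads N, if t.2.2.1 = t.2.2.2 then h t.1 t.2.1 else 0) +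
      (∑ t ∈ quads N, if t.2.2.1 < t.2.2.2 then h t.1 t.2.1 else 0) := by
    intro h
    rw [← Finset.sum_add_distrib, ← Finset.sum_add_distrib]
    refine Finset.sum_congr rfl fun t _ => ?_
    rcases lt_trichotomy t.2.2.1 t.2.2.2 with h | h | h
    · simp [h, h.ne, h.not_gt]
    · simp [h]
    · simp [h, h.ne', h.not_gt]
  have left : ∀ h : ℕ → ℕ → ℚ, ∑ t ∈ quads N, h t.1 t.2.1 =
      (∑ t ∈ quads N, if t.2.1 < t.1 then h t.1 t.2.1 else 0) +
      (∑ t ∈ quads N, if t.1 = t.2.1 then h t.1 t.2.1 else 0) +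
      (∑ t ∈ quads N, if t.1 < t.2.1 then h t.1 t.2.1 else 0) := by
    intro h
    rw [← Finset.sum_add_distrib, ← Finset.sum_add_distrib]
    refine Finset.sum_congr rfl fun t _ => ?_
    rcases lt_trichotomy t.1 t.2.1 with h | h | h
    · simp [h, h.ne, h.not_gt]
    · simp [h]
    · simp [h, h.ne', h.not_gt]
  -- By swap and shear, `∑ f(a+b)` is `2 ∑_{a>b} f(a)` plus its `x = y` part, and `∑ f(a-b)` is `2
  -- ∑_{x<y} f(a)` plus its `a = b` part. Splitting `∑ f(a)` in both ways, where `∑_{x>y} f(a) =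
  -- ∑_{a<b} f(a)`, shows that these two main terms differ by diagonal sums only.
  have e1 := right fun a b => f (a + b)
  have e2 := sum_quads_swap N fun a b x y => if x < y then f (a + b) else 0
  have e3 := sum_quads_shear N fun a b => f (a + b)
  have e4 := left fun a b => f (a - b)
  have e5 := sum_quads_swap N fun a b x y => if a < b then f (a - b) else 0
  have e6 := sum_quads_shear N fun a b => f b
  have e7 := sum_quads_swap N fun a b x y => if y < x then f b else 0
  have e8 := left fun a b => f a
  have e9 := right fun a b => f a
  have e10 := sum_quads_shear N fun a b => f a
  have e11 := sum_quads_swap N fun a b x y => if b < a then f b else 0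
  have e12 := sum_quads_diag_left N fun a => f 0 + 2 * f a
  have e13 := sum_quads_diag_right N fun a b => f (a + b) + 2 * f a
  have c3 : (∑ t ∈ quads N, if t.2.1 < t.1 then f ((t.2.1 : ℚ) + ((t.1 - t.2.1 : ℕ) : ℚ)) else 0) =
      ∑ t ∈ quads N, if t.2.1 < t.1 then f t.1 else 0 := by
    refine Finset.sum_congr rfl fun t _ => ?_
    split_ifs with h
    · rw [Nat.cast_sub h.le, add_sub_cancel]
    · rfl
  have c5 : (∑ t ∈ quads N, if t.2.1 < t.1 then f ((t.2.1 : ℚ) - t.1) else 0) =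
      ∑ t ∈ quads N, if t.2.1 < t.1 then f ((t.1 : ℚ) - t.2.1) else 0 := by
    refine Finset.sum_congr rfl fun t _ => ?_
    rw [← hf, neg_sub]
  have c6 : (∑ t ∈ quads N, if t.2.1 < t.1 then f ((t.1 - t.2.1 : ℕ) : ℚ) else 0) =
      ∑ t ∈ quads N, if t.2.1 < t.1 then f ((t.1 : ℚ) - t.2.1) else 0 := by
    refine Finset.sum_congr rfl fun t _ => ?_
    split_ifs with h
    · rw [Nat.cast_sub h.le]
    · rfl
  have c4 : (∑ t ∈ quads N, if t.1 = t.2.1 then f ((t.1 : ℚ) - t.2.1) else 0) =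
      ∑ t ∈ quads N, if t.1 = t.2.1 then f 0 else 0 := by
    refine Finset.sum_congr rfl fun t _ => ?_
    split_ifs with h
    · rw [h, sub_self]
    · rfl
  have c2 : (∑ t ∈ quads N, if t.2.2.2 < t.2.2.1 then f ((t.2.1 : ℚ) + t.1) else 0) =
      ∑ t ∈ quads N, if t.2.2.2 < t.2.2.1 then f ((t.1 : ℚ) + t.2.1) else 0 := by
    refine Finset.sum_congr rfl fun t _ => ?_
    rw [add_comm]
  have c12 : (∑ t ∈ quads N, if t.1 = t.2.1 then f 0 + 2 * f t.1 else 0) =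
      (∑ t ∈ quads N, if t.1 = t.2.1 then f 0 else 0) +
        2 * ∑ t ∈ quads N, if t.1 = t.2.1 then f t.1 else 0 := by
    rw [Finset.mul_sum, ← Finset.sum_add_distrib]
    exact Finset.sum_congr rfl fun t _ => by split_ifs <;> simp
  have c13 : (∑ t ∈ quads N, if t.2.2.1 = t.2.2.2 then f (t.1 + t.2.1) + 2 * f t.1 else 0) =
      (∑ t ∈ quads N, if t.2.2.1 = t.2.2.2 then f (t.1 + t.2.1) else 0) +
        2 * ∑ t ∈ quads N, if t.2.2.1 = t.2.2.2 then f t.1 else 0 := by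
    rw [Finset.mul_sum, ← Finset.sum_add_distrib]
    exact Finset.sum_congr rfl fun t _ => by split_ifs <;> simp
  have d13 : ∑ m ∈ N.divisors, ∑ a ∈ Finset.Ico 1 m, (f ((a : ℚ) + ((m - a : ℕ) : ℚ)) + 2 * f a) =
      ∑ m ∈ N.divisors, ∑ a ∈ Finset.Ico 1 m, (f m + 2 * f a) := by
    refine Finset.sum_congr rfl fun m _ => Finset.sum_congr rfl fun a ha => ?_
    rw [Nat.cast_sub (Finset.mem_Ico.1 ha).2.le, add_sub_cancel]
  rw [Finset.sum_sub_distrib, ← e12, ← d13, ← e13, c12, c13]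
  linarith

/-! ### Ramanujan-type formula: quasimodular forms are closed under `q d/dq`. -/

theorem coeff_divisorSeries_mul (i j N : ℕ) :
    coeff N (divisorSeries i * divisorSeries j) =
      ∑ t ∈ quads N, (t.1 : ℚ) ^ i * (t.2.1 : ℚ) ^ j := by
  simp only [coeff_mul, divisorSeries, coeff_mk, Finset.sum_mul_sum]
  simp only [← Finset.sum_product', Finset.sum_sigma']
  refine Finset.sum_bij' (fun s _ => (s.2.1, s.2.2, s.1.1 / s.2.1, s.1.2 / s.2.2))
    (fun t _ => (⟨(t.1 * t.2.2.1, t.2.1 * t.2.2.2), (t.1, t.2.1)⟩ : Σ _ : ℕ × ℕ, ℕ × ℕ))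
    ?_ ?_ ?_ ?_ ?_
  · rintro ⟨⟨u, v⟩, a, b⟩ hs
    simp only [Finset.mem_sigma, Finset.HasAntidiagonal.mem_antidiagonal, Finset.mem_product] at hs
    obtain ⟨h, ha, hb⟩ := hs
    refine mem_quads.2 ⟨Nat.pos_of_mem_divisors ha, Nat.pos_of_mem_divisors hb,
      Nat.div_pos (Nat.divisor_le ha) (Nat.pos_of_mem_divisors ha),
      Nat.div_pos (Nat.divisor_le hb) (Nat.pos_of_mem_divisors hb), ?_⟩
    rw [Nat.mul_div_cancel' (Nat.dvd_of_mem_divisors ha),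
      Nat.mul_div_cancel' (Nat.dvd_of_mem_divisors hb), h]
  · rintro ⟨a, b, x, y⟩ ht
    obtain ⟨ha, hb, hx, hy, h⟩ := mem_quads.1 ht
    simp only [Finset.mem_sigma, Finset.HasAntidiagonal.mem_antidiagonal, Finset.mem_product, Nat.mem_divisors]
    exact ⟨h, ⟨Dvd.intro _ rfl, by positivity⟩, Dvd.intro _ rfl, by positivity⟩
  · rintro ⟨⟨u, v⟩, a, b⟩ hs
    simp only [Finset.mem_sigma, Finset.HasAntidiagonal.mem_antidiagonal, Finset.mem_product] at hs
    obtain ⟨h, ha, hb⟩ := hs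
    simp only [Nat.mul_div_cancel' (Nat.dvd_of_mem_divisors ha),
      Nat.mul_div_cancel' (Nat.dvd_of_mem_divisors hb)]
  · rintro ⟨a, b, x, y⟩ ht
    obtain ⟨ha, hb, hx, hy, h⟩ := mem_quads.1 ht
    simp [Nat.mul_div_cancel_left _ ha, Nat.mul_div_cancel_left _ hb]
  · rintro ⟨⟨u, v⟩, a, b⟩ hs
    rfl

theorem coeff_qDeriv (F : PowerSeries ℚ) (N : ℕ) : coeff N (qDeriv F) = N * coeff N F := by
  cases N with
  | zero => simp [qDeriv]
  | succ N =>
    rw [qDeriv, coeff_succ_X_mul, coeff_derivative]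
    push_cast
    ring

/-- `q d/dq` as a derivation. -/
def qDerivation : Derivation ℚ (PowerSeries ℚ) (PowerSeries ℚ) :=
  (PowerSeries.X : PowerSeries ℚ) • PowerSeries.derivative ℚ

theorem qDerivation_apply (F : PowerSeries ℚ) : qDerivation F = qDeriv F := rfl

theorem eisensteinG_eq (k : ℕ) : eisensteinG k =
    algebraMap ℚ (PowerSeries ℚ) (-(_root_.bernoulli k) / (2 * (k.factorial : ℚ))) +
      (1 / ((k - 1).factorial : ℚ)) • divisorSeries (k - 1) := by
  rw [PowerSeries.smul_eq_C_mul]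
  rfl

theorem divisorSeries_eq (k : ℕ) : divisorSeries (k - 1) = ((k - 1).factorial : ℚ) •
    (eisensteinG k -
      algebraMap ℚ (PowerSeries ℚ) (-(_root_.bernoulli k) / (2 * (k.factorial : ℚ)))) := by
  have h : ((k - 1).factorial : ℚ) ≠ 0 := by positivity
  rw [eisensteinG_eq, add_sub_cancel_left, smul_smul, mul_one_div_cancel h, one_smul]

theorem divisorSeries_mem_of_eisensteinG_mem (S : Subalgebra ℚ (PowerSeries ℚ))
    (hS : ∀ k, 2 ≤ k → Even k → eisensteinG k ∈ S) {l : ℕ} (hl : Odd l) : divisorSeries l ∈ S := by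
  have h := hS (l + 1) (by have := hl.pos; omega) hl.add_one
  have e := divisorSeries_eq (l + 1)
  rw [Nat.add_sub_cancel] at e
  rw [e]
  exact S.smul_mem (S.sub_mem h (S.algebraMap_mem _)) _

theorem divisorSeries_mem_quasimodularForms {l : ℕ} (hl : Odd l) :
    divisorSeries l ∈ quasimodularForms :=
  divisorSeries_mem_of_eisensteinG_mem _
    (fun k h2 hk => Algebra.subset_adjoin (Set.mem_ofPred_eq ▸ ⟨k, h2, hk, rfl⟩)) hl

/-- The added `m^p` cancels the `B_1 = -1/2` term of Faulhaber's formula. As the other odd Bernoulli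
numbers vanish, only odd powers of `m` survive when `p` is even. -/
theorem two_mul_sum_range_pow_add {p : ℕ} (hp : 0 < p) (m : ℕ) :
    2 * ∑ a ∈ Finset.range m, (a : ℚ) ^ p + (m : ℚ) ^ p =
      ∑ i ∈ (Finset.range (p + 1)).erase 1,
        (2 * _root_.bernoulli i * ((p + 1).choose i) / (p + 1)) * (m : ℚ) ^ (p + 1 - i) := by
  have h1 : 1 ∈ Finset.range (p + 1) := Finset.mem_range.2 (by omega)
  rw [sum_range_pow, ← Finset.add_sum_erase _ _ h1, bernoulli_one, mul_add, Finset.mul_sum]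
  have h0 : (p : ℚ) + 1 ≠ 0 := by positivity
  have e : (2 : ℚ) * (-1 / 2 * ((p + 1).choose 1 : ℕ) * (m : ℚ) ^ (p + 1 - 1) / (p + 1)) =
      -(m : ℚ) ^ p := by
    rw [Nat.choose_one_right, Nat.add_sub_cancel]
    push_cast
    field_simp
  rw [e, add_right_comm, neg_add_cancel, zero_add]
  exact Finset.sum_congr rfl fun i _ => by ring

/-- Ramanujan's formula for the derivative of an Eisenstein series of weight `2 * l`. -/
theorem two_smul_qDeriv_divisorSeries {l : ℕ} (hl : 0 < l) :
    (2 : ℚ) • qDeriv (divisorSeries (2 * l - 1)) =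
      (∑ i ∈ Finset.range (2 * l + 1), (((-1 : ℚ) ^ (2 * l - i) - 1) * (2 * l).choose i) •
        (divisorSeries i * divisorSeries (2 * l - i))) +
      (∑ i ∈ (Finset.range (2 * l + 1)).erase 1,
        (2 * _root_.bernoulli i * ((2 * l + 1).choose i) / ((2 * l : ℕ) + 1)) •
          divisorSeries (2 * l + 1 - i)) + divisorSeries (2 * l + 1) := by
  ext N
  simp only [map_add, map_sum, coeff_smul, coeff_divisorSeries_mul, coeff_qDeriv, smul_eq_mul]
  have h := sum_quads_sub_add N (fun x => x ^ (2 * l)) fun x => (even_two_mul l).neg_pow x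
  -- In the binomial expansion of `(a-b)^(2l) - (a+b)^(2l)` only odd exponents have a nonzero
  -- coefficient.
  have e1 : ∑ i ∈ Finset.range (2 * l + 1), (((-1 : ℚ) ^ (2 * l - i) - 1) * (2 * l).choose i) *
      ∑ t ∈ quads N, (t.1 : ℚ) ^ i * (t.2.1 : ℚ) ^ (2 * l - i) =
      ∑ t ∈ quads N, (((t.1 : ℚ) - t.2.1) ^ (2 * l) - ((t.1 : ℚ) + t.2.1) ^ (2 * l)) := by
    simp_rw [Finset.mul_sum]
    rw [Finset.sum_comm]
    refine Finset.sum_congr rfl fun t _ => ?_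
    rw [sub_eq_add_neg (t.1 : ℚ), add_pow, add_pow, ← Finset.sum_sub_distrib]
    refine Finset.sum_congr rfl fun i _ => ?_
    rw [neg_pow (t.2.1 : ℚ)]
    ring
  rw [e1, h]
  simp only [divisorSeries, coeff_mk, Finset.mul_sum]
  rw [Finset.sum_comm (s := (Finset.range (2 * l + 1)).erase 1), ← Finset.sum_sub_distrib,
    ← Finset.sum_add_distrib, ← Finset.sum_add_distrib]
  refine Finset.sum_congr rfl fun m hm => ?_
  have hm0 : 0 < m := Nat.pos_of_mem_divisors hm
  have hm' : (m : ℚ) ≠ 0 := by positivity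
  -- The identity now holds divisor by divisor. Faulhaber's sum starts at `a = 0` and Liouville's at
  -- `a = 1`; the extra term is `0^(2l) = 0`.
  rw [← two_mul_sum_range_pow_add (by omega : 0 < 2 * l), Finset.sum_add_distrib, ← Finset.mul_sum,
    Finset.sum_const, Nat.card_Ico, nsmul_eq_mul, Nat.cast_sub hm0, Nat.cast_one,
    Finset.range_eq_Ico, Finset.sum_eq_sum_Ico_succ_bot hm0]
  obtain ⟨j, rfl⟩ : ∃ j, l = j + 1 := ⟨l - 1, by omega⟩
  rw [show 2 * (j + 1) - 1 = 2 * j + 1 by omega, show 2 * (j + 1) = 2 * j + 1 + 1 by ring]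
  simp only [Nat.cast_zero, ne_eq, Nat.add_eq_zero_iff, one_ne_zero, and_false,
    not_false_eq_true, zero_pow, zero_add]
  field_simp
  ring

theorem qDeriv_divisorSeries_mem {l : ℕ} (hl : Odd l) :
    qDeriv (divisorSeries l) ∈ quasimodularForms := by
  obtain ⟨j, rfl⟩ := hl
  have h := two_smul_qDeriv_divisorSeries (Nat.succ_pos j)
  rw [show 2 * j.succ - 1 = 2 * j + 1 by omega] at h
  have h2 : qDeriv (divisorSeries (2 * j + 1)) =
      (1 / 2 : ℚ) • (2 : ℚ) • qDeriv (divisorSeries (2 * j + 1)) := by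
    rw [smul_smul]; norm_num
  rw [h2, h]
  refine Subalgebra.smul_mem _ (add_mem (add_mem (sum_mem fun i hi => ?_) (sum_mem fun i hi => ?_))
    (divisorSeries_mem_quasimodularForms ⟨_, rfl⟩)) _
  · rw [Finset.mem_range] at hi
    -- Products of divisor series with even exponents, including `i = 0` and `i = 2l`, have
    -- coefficient zero.
    rcases Nat.even_or_odd i with he | ho
    · have h3 : Even (2 * j.succ - i) := by
        rw [Nat.even_sub (by omega)]; simp [he]
      simp [h3.neg_one_pow]
    · have h3 : Odd (2 * j.succ - i) := Nat.Even.sub_odd (by omega) (even_two_mul _) ho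
      exact Subalgebra.smul_mem _ (mul_mem (divisorSeries_mem_quasimodularForms ho)
        (divisorSeries_mem_quasimodularForms h3)) _
  · rw [Finset.mem_erase, Finset.mem_range] at hi
    rcases Nat.even_or_odd i with he | ho
    · refine Subalgebra.smul_mem _ (divisorSeries_mem_quasimodularForms ?_) _
      rw [Nat.odd_sub (by omega)]
      simp [he]
    · have h1 : 1 < i := by have := ho.pos; omega
      simp [bernoulli_eq_zero_of_odd ho h1]

theorem derivation_mem_adjoin {A : Type*} [CommRing A] [Algebra ℚ A] (D : Derivation ℚ A A)
    (s : Set A) (hs : ∀ x ∈ s, D x ∈ Algebra.adjoin ℚ s) {x : A} (hx : x ∈ Algebra.adjoin ℚ s) :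
    D x ∈ Algebra.adjoin ℚ s := by
  induction hx using Algebra.adjoin_induction with
  | mem x hx => exact hs x hx
  | algebraMap r => simp
  | add x y _ _ ihx ihy => rw [map_add]; exact add_mem ihx ihy
  | mul x y hx hy ihx ihy =>
    rw [Derivation.leibniz, smul_eq_mul, smul_eq_mul]
    exact add_mem (mul_mem hx ihy) (mul_mem hy ihx)

theorem qDeriv_eisensteinG (k : ℕ) : qDeriv (eisensteinG k) =
    (1 / ((k - 1).factorial : ℚ)) • qDeriv (divisorSeries (k - 1)) := by
  rw [eisensteinG_eq, ← qDerivation_apply, map_add, Derivation.map_algebraMap, zero_add,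
    Derivation.map_smul, qDerivation_apply]

theorem qDeriv_mem_quasimodularForms {F : PowerSeries ℚ} (hF : F ∈ quasimodularForms) :
    qDeriv F ∈ quasimodularForms := by
  refine derivation_mem_adjoin qDerivation _ ?_ hF
  rintro _ ⟨k, h2, hk, rfl⟩
  rw [qDerivation_apply, qDeriv_eisensteinG]
  exact Subalgebra.smul_mem _ (qDeriv_divisorSeries_mem (Nat.Even.sub_odd (by omega) hk odd_one)) _

theorem iterate_qDeriv_mem_quasimodularForms {F : PowerSeries ℚ} (hF : F ∈ quasimodularForms)
    (a : ℕ) : qDeriv^[a] F ∈ quasimodularForms := by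
  induction a with
  | zero => exact hF
  | succ a ih =>
    rw [Function.iterate_succ_apply']
    exact qDeriv_mem_quasimodularForms ih

theorem eisensteinDerivativeAlgebra_le : eisensteinDerivativeAlgebra ≤ quasimodularForms := by
  refine Algebra.adjoin_le ?_
  rintro _ ⟨a, k, h2, hk, rfl⟩
  exact iterate_qDeriv_mem_quasimodularForms (Algebra.subset_adjoin ⟨k, h2, hk, rfl⟩) a

/-! ### Parity of powers of the series `∑ r^l x^r`. -/

/-- The power series `∑ r ^ l x ^ r`. -/
def powSeries (l : ℕ) : PowerSeries ℚ := PowerSeries.mk fun r => (r : ℚ) ^ l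

theorem powSeries_succ (l : ℕ) : powSeries (l + 1) = qDerivation (powSeries l) := by
  ext r
  rw [qDerivation_apply, coeff_qDeriv, powSeries, powSeries, coeff_mk, coeff_mk, pow_succ']

/-- As `0^0 = 1`, the series `powSeries 0` is `1 / (1 - x)`; differentiate `powSeries 0 * (1 - x) =
1`. -/
theorem qDerivation_powSeries_zero :
    qDerivation (powSeries 0) = powSeries 0 ^ 2 - powSeries 0 := by
  have h : powSeries 0 * (1 - X) = 1 := by
    rw [show powSeries 0 = PowerSeries.mk 1 by ext r; simp [powSeries],
      mk_one_mul_one_sub_eq_one]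
  have hd := congrArg qDerivation h
  have hX : qDerivation (X : PowerSeries ℚ) = X := by
    rw [qDerivation_apply, qDeriv, derivative_X, mul_one]
  rw [Derivation.leibniz, map_sub, hX, Derivation.map_one_eq_zero, smul_eq_mul, smul_eq_mul,
    zero_sub] at hd
  linear_combination powSeries 0 * hd - (qDerivation (powSeries 0) + powSeries 0) * h

/-- The power series `(1 + x) / (1 - x)`. -/
def cothSeries : PowerSeries ℚ := 2 * powSeries 0 - 1

theorem powSeries_one_eq : powSeries 1 = powSeries 0 ^ 2 - powSeries 0 := by
  rw [powSeries_succ 0, qDerivation_powSeries_zero]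

theorem cothSeries_sq : cothSeries ^ 2 = 1 + 4 * powSeries 1 := by
  rw [cothSeries, powSeries_one_eq]; ring

theorem qDerivation_powSeries_one :
    qDerivation (powSeries 1) = powSeries 1 * cothSeries := by
  rw [powSeries_one_eq, map_sub, Derivation.leibniz_pow, qDerivation_powSeries_zero, cothSeries]
  simp only [smul_eq_mul, nsmul_eq_mul, Nat.add_one_sub_one, pow_one]
  push_cast
  ring

theorem qDerivation_cothSeries : qDerivation cothSeries = 2 * powSeries 1 := by
  have : cothSeries = (2 : ℚ) • powSeries 0 - 1 := by
    rw [cothSeries, two_mul, two_smul]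
  rw [this, map_sub, Derivation.map_one_eq_zero, Derivation.map_smul, qDerivation_powSeries_zero,
    powSeries_one_eq, two_smul]
  ring

theorem qDerivation_powSeries_one_pow (i : ℕ) :
    qDerivation (powSeries 1 ^ (i + 1)) = ((i : ℚ) + 1) • (cothSeries * powSeries 1 ^ (i + 1)) := by
  rw [Derivation.leibniz_pow, qDerivation_powSeries_one, Nat.add_sub_cancel, smul_eq_mul,
    ← Nat.cast_succ, Nat.cast_smul_eq_nsmul]
  congr 1
  ring

/-- With `u = x / (1-x)^2` and `c = (1+x) / (1-x)` one has `D u = c u`, `D c = 2 u` and `c^2 = 1 + 4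
u`. So two derivatives return to polynomials in `u`, with a nonzero top coefficient. -/
theorem qDerivation_qDerivation_powSeries_one_pow (i : ℕ) :
    qDerivation (qDerivation (powSeries 1 ^ (i + 1))) =
      ((i : ℚ) + 1) ^ 2 • powSeries 1 ^ (i + 1) +
        (4 * ((i : ℚ) + 1) ^ 2 + 2 * ((i : ℚ) + 1)) • powSeries 1 ^ (i + 1 + 1) := by
  rw [qDerivation_powSeries_one_pow, Derivation.map_smul, Derivation.leibniz,
    qDerivation_powSeries_one_pow, qDerivation_cothSeries]
  simp only [smul_eq_mul, smul_eq_C_mul]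
  simp only [map_add, map_mul, map_pow, map_ofNat]
  linear_combination (C ((i : ℚ)) + C 1) ^ 2 * powSeries 1 ^ (i + 1) * cothSeries_sq

/-- The polynomials without constant term in `x / (1 - x) ^ 2`. -/
def symmSeries : Submodule ℚ (PowerSeries ℚ) :=
  Submodule.span ℚ (Set.range fun i : ℕ => powSeries 1 ^ (i + 1))

/-- The span of the power series `∑ r ^ l x ^ r` for odd `l`. -/
def oddPowSeries : Submodule ℚ (PowerSeries ℚ) :=
  Submodule.span ℚ (Set.range fun j : ℕ => powSeries (2 * j + 1))

/-- The span of the power series `∑ r ^ l x ^ r` for even `l ≥ 2`. -/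
def evenPowSeries : Submodule ℚ (PowerSeries ℚ) :=
  Submodule.span ℚ (Set.range fun j : ℕ => powSeries (2 * j + 2))

theorem powSeries_one_pow_mem (i : ℕ) : powSeries 1 ^ (i + 1) ∈ symmSeries :=
  Submodule.subset_span ⟨i, rfl⟩

theorem mul_mem_symmSeries {f g : PowerSeries ℚ} (hf : f ∈ symmSeries) (hg : g ∈ symmSeries) :
    f * g ∈ symmSeries := by
  have h := Submodule.mul_mem_mul hf hg
  rw [symmSeries, Submodule.span_mul_span] at h
  refine Submodule.span_mono ?_ h
  rintro _ ⟨_, ⟨i, rfl⟩, _, ⟨j, rfl⟩, rfl⟩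
  exact ⟨i + j + 1, by simp only; ring⟩

theorem pow_mem_symmSeries {f : PowerSeries ℚ} (hf : f ∈ symmSeries) (j : ℕ) :
    f ^ (j + 1) ∈ symmSeries := by
  induction j with
  | zero => simpa using hf
  | succ j ih => rw [pow_succ]; exact mul_mem_symmSeries ih hf

theorem cothSeries_sq_pow_mul_mem {f : PowerSeries ℚ} (hf : f ∈ symmSeries) (j : ℕ) :
    (cothSeries ^ 2) ^ j * f ∈ symmSeries := by
  induction j with
  | zero => simpa using hf
  | succ j ih =>
    have h : (cothSeries ^ 2) ^ (j + 1) * f = (cothSeries ^ 2) ^ j * f +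
        (4 : ℚ) • (powSeries 1 ^ (0 + 1) * ((cothSeries ^ 2) ^ j * f)) := by
      rw [pow_succ, smul_eq_C_mul, map_ofNat]
      linear_combination (cothSeries ^ 2) ^ j * f * cothSeries_sq
    rw [h]
    exact add_mem ih (Submodule.smul_mem _ _ (mul_mem_symmSeries (powSeries_one_pow_mem 0) ih))

/-- One derivative of a polynomial in `u` extracts a single antisymmetric factor `c`. This handles
the series with even exponent, as derivatives of those with odd exponent. -/
theorem exists_qDerivation_eq {f : PowerSeries ℚ} (hf : f ∈ symmSeries) :
    ∃ g ∈ symmSeries, qDerivation f = cothSeries * g := by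
  induction hf using Submodule.span_induction with
  | mem x hx =>
    obtain ⟨i, rfl⟩ := hx
    refine ⟨((i : ℚ) + 1) • powSeries 1 ^ (i + 1),
      Submodule.smul_mem _ _ (powSeries_one_pow_mem i), ?_⟩
    simp only [qDerivation_powSeries_one_pow, mul_smul_comm]
  | zero => exact ⟨0, zero_mem _, by simp⟩
  | add x y _ _ hx hy =>
    obtain ⟨a, ha, hxa⟩ := hx
    obtain ⟨b, hb, hyb⟩ := hy
    exact ⟨a + b, add_mem ha hb, by rw [map_add, hxa, hyb, mul_add]⟩
  | smul r x _ hx =>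
    obtain ⟨a, ha, hxa⟩ := hx
    exact ⟨r • a, Submodule.smul_mem _ _ ha, by rw [Derivation.map_smul, hxa, mul_smul_comm]⟩

theorem qDerivation_qDerivation_mem_symmSeries {f : PowerSeries ℚ} (hf : f ∈ symmSeries) :
    qDerivation (qDerivation f) ∈ symmSeries := by
  induction hf using Submodule.span_induction with
  | mem x hx =>
    obtain ⟨i, rfl⟩ := hx
    simp only [qDerivation_qDerivation_powSeries_one_pow]
    exact add_mem (Submodule.smul_mem _ _ (powSeries_one_pow_mem _))
      (Submodule.smul_mem _ _ (powSeries_one_pow_mem _))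
  | zero => simp
  | add x y _ _ hx hy => rw [map_add, map_add]; exact add_mem hx hy
  | smul r x _ hx =>
    rw [Derivation.map_smul, Derivation.map_smul]; exact Submodule.smul_mem _ _ hx

theorem powSeries_odd_mem_symmSeries (j : ℕ) : powSeries (2 * j + 1) ∈ symmSeries := by
  induction j with
  | zero => simpa using powSeries_one_pow_mem 0
  | succ j ih =>
    rw [show 2 * (j + 1) + 1 = 2 * j + 1 + 1 + 1 by ring, powSeries_succ, powSeries_succ]
    exact qDerivation_qDerivation_mem_symmSeries ih

theorem qDerivation_mem_evenPowSeries {f : PowerSeries ℚ} (hf : f ∈ oddPowSeries) :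
    qDerivation f ∈ evenPowSeries := by
  induction hf using Submodule.span_induction with
  | mem x hx =>
    obtain ⟨j, rfl⟩ := hx
    exact Submodule.subset_span ⟨j, powSeries_succ _⟩
  | zero => simp
  | add x y _ _ hx hy => rw [map_add]; exact add_mem hx hy
  | smul r x _ hx => rw [Derivation.map_smul]; exact Submodule.smul_mem _ _ hx

theorem qDerivation_mem_oddPowSeries {f : PowerSeries ℚ} (hf : f ∈ evenPowSeries) :
    qDerivation f ∈ oddPowSeries := by
  induction hf using Submodule.span_induction with
  | mem x hx =>
    obtain ⟨j, rfl⟩ := hx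
    exact Submodule.subset_span ⟨j + 1, powSeries_succ _⟩
  | zero => simp
  | add x y _ _ hx hy => rw [map_add]; exact add_mem hx hy
  | smul r x _ hx => rw [Derivation.map_smul]; exact Submodule.smul_mem _ _ hx

/-- The formula for the second derivative of `u^(i+1)` can be solved for `u^(i+2)`, and two
derivatives preserve the span of the odd-exponent series. -/
theorem powSeries_one_pow_mem_oddPowSeries (i : ℕ) : powSeries 1 ^ (i + 1) ∈ oddPowSeries := by
  induction i with
  | zero => rw [zero_add, pow_one]; exact Submodule.subset_span ⟨0, rfl⟩
  | succ i ih =>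
    have hc : 4 * ((i : ℚ) + 1) ^ 2 + 2 * ((i : ℚ) + 1) ≠ 0 := by positivity
    rw [← Submodule.smul_mem_iff _ hc, ← add_sub_cancel_left
      (((i : ℚ) + 1) ^ 2 • powSeries 1 ^ (i + 1)) ((4 * ((i : ℚ) + 1) ^ 2 + 2 * ((i : ℚ) + 1)) • _),
      ← qDerivation_qDerivation_powSeries_one_pow]
    exact sub_mem (qDerivation_mem_oddPowSeries (qDerivation_mem_evenPowSeries ih))
      (Submodule.smul_mem _ _ ih)

theorem symmSeries_le : symmSeries ≤ oddPowSeries := by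
  rw [symmSeries, Submodule.span_le]
  rintro _ ⟨i, rfl⟩
  exact powSeries_one_pow_mem_oddPowSeries i

/-- Up to a nonzero scalar, `c u^(i+1)` is the derivative of `u^(i+1)`, which lies in the span of
the odd-exponent series. -/
theorem cothSeries_mul_mem {f : PowerSeries ℚ} (hf : f ∈ symmSeries) :
    cothSeries * f ∈ evenPowSeries := by
  induction hf using Submodule.span_induction with
  | mem x hx =>
    obtain ⟨i, rfl⟩ := hx
    have hc : (i : ℚ) + 1 ≠ 0 := by positivity
    rw [← Submodule.smul_mem_iff _ hc, ← qDerivation_powSeries_one_pow]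
    exact qDerivation_mem_evenPowSeries (powSeries_one_pow_mem_oddPowSeries i)
  | zero => simp
  | add x y _ _ hx hy => rw [mul_add]; exact add_mem hx hy
  | smul r x _ hx => rw [mul_smul_comm]; exact Submodule.smul_mem _ _ hx

/-- Powers of `∑ r ^ l x ^ r` are combinations of such series, with `l` of a fixed parity. -/
theorem powSeries_pow_mem {l j : ℕ} (hl : 0 < l) (hj : 0 < j) :
    powSeries l ^ j ∈ Submodule.span ℚ {F | ∃ i, Odd (i + (l + 1) * j) ∧ F = powSeries i} := by
  obtain ⟨j, rfl⟩ : ∃ i, j = i + 1 := ⟨j - 1, by omega⟩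
  have hodd : Even ((l + 1) * (j + 1)) → oddPowSeries ≤
      Submodule.span ℚ {F | ∃ i, Odd (i + (l + 1) * (j + 1)) ∧ F = powSeries i} := fun h => by
    rw [oddPowSeries]
    refine Submodule.span_mono ?_
    rintro _ ⟨i, rfl⟩
    exact ⟨_, Odd.add_even ⟨i, rfl⟩ h, rfl⟩
  have heven : Odd ((l + 1) * (j + 1)) → evenPowSeries ≤
      Submodule.span ℚ {F | ∃ i, Odd (i + (l + 1) * (j + 1)) ∧ F = powSeries i} := fun h => by
    rw [evenPowSeries]
    refine Submodule.span_mono ?_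
    rintro _ ⟨i, rfl⟩
    exact ⟨_, Even.add_odd ⟨i + 1, by ring⟩ h, rfl⟩
  rcases Nat.even_or_odd l with he | ho
  · obtain ⟨i, rfl⟩ : ∃ i, l = 2 * i + 1 + 1 := by
      obtain ⟨c, rfl⟩ := he
      exact ⟨c - 1, by omega⟩
    -- The series with even exponent is `c g` with `g` a polynomial in `u`. In its power, each `c^2`
    -- is `1 + 4 u`, so the parity of the exponent decides whether one factor `c` remains.
    obtain ⟨g, hg, hgl⟩ := exists_qDerivation_eq (powSeries_odd_mem_symmSeries i)
    have hgj := pow_mem_symmSeries hg j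
    rw [powSeries_succ (2 * i + 1), hgl, mul_pow]
    rcases Nat.even_or_odd (j + 1) with ⟨c, hc⟩ | ⟨c, hc⟩
    · refine hodd ⟨(2 * i + 1 + 1 + 1) * c, by rw [hc]; ring⟩ (symmSeries_le ?_)
      have h := cothSeries_sq_pow_mul_mem hgj c
      rwa [← pow_mul, two_mul, ← hc] at h
    · refine heven (Odd.mul ⟨i + 1, by ring⟩ ⟨c, hc⟩) ?_
      have h := cothSeries_mul_mem (cothSeries_sq_pow_mul_mem hgj c)
      rwa [← mul_assoc, ← pow_mul, ← pow_succ', ← hc] at h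
  · obtain ⟨i, rfl⟩ := ho
    refine hodd ⟨(i + 1) * (j + 1), by ring⟩ (symmSeries_le ?_)
    exact pow_mem_symmSeries (powSeries_odd_mem_symmSeries i) j

/-! ### Sums `∑ m^e H(q^m)` as derivatives of Eisenstein series. -/

theorem eisensteinG_mem_eisensteinDerivativeAlgebra {k : ℕ} (h2 : 2 ≤ k) (hk : Even k) :
    eisensteinG k ∈ eisensteinDerivativeAlgebra :=
  Algebra.subset_adjoin (Set.mem_ofPred_eq ▸ ⟨0, k, h2, hk, rfl⟩)

theorem qDeriv_mem_eisensteinDerivativeAlgebra {F : PowerSeries ℚ}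
    (hF : F ∈ eisensteinDerivativeAlgebra) : qDeriv F ∈ eisensteinDerivativeAlgebra := by
  refine derivation_mem_adjoin qDerivation _ ?_ hF
  rintro _ ⟨a, k, h2, hk, rfl⟩
  refine Algebra.subset_adjoin ⟨a + 1, k, h2, hk, ?_⟩
  rw [Function.iterate_succ_apply', qDerivation_apply]

theorem iterate_qDeriv_divisorSeries_mem {l : ℕ} (hl : Odd l) (a : ℕ) :
    qDeriv^[a] (divisorSeries l) ∈ eisensteinDerivativeAlgebra := by
  induction a with
  | zero =>
    exact divisorSeries_mem_of_eisensteinG_mem _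
      (fun _ h2 hk => eisensteinG_mem_eisensteinDerivativeAlgebra h2 hk) hl
  | succ a ih =>
    rw [Function.iterate_succ_apply']
    exact qDeriv_mem_eisensteinDerivativeAlgebra ih

theorem coeff_iterate_qDeriv (F : PowerSeries ℚ) (a N : ℕ) :
    coeff N (qDeriv^[a] F) = (N : ℚ) ^ a * coeff N F := by
  induction a with
  | zero => simp
  | succ a ih => rw [Function.iterate_succ_apply', coeff_qDeriv, ih, pow_succ']; ring

/-- The linear map sending `H` to `∑_{m ≥ 1} m ^ e * H(q ^ m)` if `H` has no constant term. -/
def divisorTransform (e : ℕ) : PowerSeries ℚ →ₗ[ℚ] PowerSeries ℚ where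
  toFun H := PowerSeries.mk fun N => ∑ m ∈ N.divisors, (m : ℚ) ^ e * coeff (N / m) H
  map_add' H H' := by
    ext N
    simp [mul_add, Finset.sum_add_distrib]
  map_smul' c H := by
    ext N
    simp only [coeff_mk, coeff_smul, smul_eq_mul, Finset.mul_sum, RingHom.id_apply]
    exact Finset.sum_congr rfl fun _ _ => by ring

theorem coeff_divisorTransform (e N : ℕ) (H : PowerSeries ℚ) : coeff N (divisorTransform e H) =
    ∑ m ∈ N.divisors, (m : ℚ) ^ e * coeff (N / m) H := by
  simp [divisorTransform]

/-- The `N`-th coefficient is the sum of `m^e r^l` over `m r = N`. Pulling out `N` to the smaller of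
the two exponents leaves a divisor sum of exponent `|e - l|`, which is odd. -/
theorem divisorTransform_powSeries_mem {e l : ℕ} (h : Odd (e + l)) :
    divisorTransform e (powSeries l) ∈ eisensteinDerivativeAlgebra := by
  rcases le_total l e with hle | hle
  · obtain ⟨c, rfl⟩ := Nat.exists_eq_add_of_le hle
    have hc : Odd c := by
      rw [show l + c + l = 2 * l + c by ring] at h
      exact (Nat.odd_add'.1 h).2 (even_two_mul l)
    convert iterate_qDeriv_divisorSeries_mem hc l using 1
    ext N
    rw [coeff_divisorTransform, coeff_iterate_qDeriv, divisorSeries, powSeries, coeff_mk,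
      Finset.mul_sum]
    refine Finset.sum_congr rfl fun m hm => ?_
    have h1 : (m : ℚ) * ((N / m : ℕ) : ℚ) = N := by
      rw [← Nat.cast_mul, Nat.mul_div_cancel' (Nat.dvd_of_mem_divisors hm)]
    rw [coeff_mk, ← h1]
    ring
  · obtain ⟨c, rfl⟩ := Nat.exists_eq_add_of_le hle
    have hc : Odd c := by
      rw [show e + (e + c) = 2 * e + c by ring] at h
      exact (Nat.odd_add'.1 h).2 (even_two_mul e)
    convert iterate_qDeriv_divisorSeries_mem hc e using 1
    ext N
    rw [coeff_divisorTransform, coeff_iterate_qDeriv, divisorSeries, powSeries, coeff_mk,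
      ← Nat.sum_div_divisors N fun m => (m : ℚ) ^ c, Finset.mul_sum]
    refine Finset.sum_congr rfl fun m hm => ?_
    have h1 : (m : ℚ) * ((N / m : ℕ) : ℚ) = N := by
      rw [← Nat.cast_mul, Nat.mul_div_cancel' (Nat.dvd_of_mem_divisors hm)]
    rw [coeff_mk, ← h1]
    ring

theorem divisorTransform_powSeries_pow_mem {d l j : ℕ} (hl : 0 < l) (hj : 0 < j)
    (h : Odd (l + d)) :
    divisorTransform (d * j) (powSeries l ^ j) ∈ eisensteinDerivativeAlgebra := by
  have h1 := Submodule.mem_map_of_mem (f := divisorTransform (d * j)) (powSeries_pow_mem hl hj)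
  rw [Submodule.map_span] at h1
  have h2 : Submodule.span ℚ (divisorTransform (d * j) ''
      {F | ∃ i, Odd (i + (l + 1) * j) ∧ F = powSeries i}) ≤
      Subalgebra.toSubmodule eisensteinDerivativeAlgebra := by
    rw [Submodule.span_le]
    rintro _ ⟨_, ⟨i, hi, rfl⟩, rfl⟩
    refine divisorTransform_powSeries_mem ?_
    -- Because `l + d + 1` is even, `(l + 1) j` has the parity of `d j`, so `d j + i` is odd.
    have h3 : Even ((l + d + 1) * j) := h.add_one.mul_right j
    have h4 : Odd (2 * (d * j) + (i + (l + 1) * j)) := (even_two_mul _).add_odd hi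
    rw [show 2 * (d * j) + (i + (l + 1) * j) = d * j + i + (l + d + 1) * j by ring] at h4
    exact (Nat.odd_add.1 h4).2 h3
  exact h2 h1

/-! ### Coefficientwise limits and the product formula for partitions. -/

/-- Coefficientwise convergence of a sequence of power series, for the discrete topology. -/
def StablyTendsto {R : Type*} [Semiring R] (u : ℕ → PowerSeries R) (L : PowerSeries R) : Prop :=
  ∀ N, ∀ᶠ M in Filter.atTop, coeff N (u M) = coeff N L

namespace StablyTendsto

variable {R : Type*} [Semiring R] {u v : ℕ → PowerSeries R} {K L : PowerSeries R}

theorem unique (hK : StablyTendsto u K) (hL : StablyTendsto u L) : K = L := by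
  ext N
  obtain ⟨M, h1, h2⟩ := ((hK N).and (hL N)).exists
  rw [← h1, h2]

theorem const_mul (c : PowerSeries R) (h : StablyTendsto u L) :
    StablyTendsto (fun M => c * u M) (c * L) := fun N => by
  have : ∀ᶠ M in Filter.atTop, ∀ i ∈ Finset.range (N + 1), coeff i (u M) = coeff i L :=
    (Filter.eventually_all_finset _).2 fun i _ => h i
  filter_upwards [this] with M hM
  rw [coeff_mul, coeff_mul]
  refine Finset.sum_congr rfl fun p hp => ?_
  rw [hM p.2 (Finset.mem_range.2 (by have := Finset.HasAntidiagonal.mem_antidiagonal.1 hp; omega))]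

theorem mul (hK : StablyTendsto u K) (hL : StablyTendsto v L) :
    StablyTendsto (fun M => u M * v M) (K * L) := fun N => by
  have h1 : ∀ᶠ M in Filter.atTop, ∀ i ∈ Finset.range (N + 1), coeff i (u M) = coeff i K :=
    (Filter.eventually_all_finset _).2 fun i _ => hK i
  have h2 : ∀ᶠ M in Filter.atTop, ∀ i ∈ Finset.range (N + 1), coeff i (v M) = coeff i L :=
    (Filter.eventually_all_finset _).2 fun i _ => hL i
  filter_upwards [h1, h2] with M hM hM'
  rw [coeff_mul, coeff_mul]
  refine Finset.sum_congr rfl fun p hp => ?_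
  have := Finset.HasAntidiagonal.mem_antidiagonal.1 hp
  rw [hM p.1 (Finset.mem_range.2 (by omega)), hM' p.2 (Finset.mem_range.2 (by omega))]

theorem sum {ι : Type*} (s : Finset ι) {u : ι → ℕ → PowerSeries R} {L : ι → PowerSeries R}
    (h : ∀ i ∈ s, StablyTendsto (u i) (L i)) :
    StablyTendsto (fun M => ∑ i ∈ s, u i M) (∑ i ∈ s, L i) := fun N => by
  have : ∀ᶠ M in Filter.atTop, ∀ i ∈ s, coeff N (u i M) = coeff N (L i) :=
    (Filter.eventually_all_finset _).2 fun i hi => h i hi N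
  filter_upwards [this] with M hM
  rw [map_sum, map_sum]
  exact Finset.sum_congr rfl hM

end StablyTendsto

/-- The `m`-th factor of the product formula for a generating function of partitions. -/
def partitionFactor {R : Type*} [Semiring R] (f : ℕ → ℕ → R) (m : ℕ) : PowerSeries R :=
  PowerSeries.mk fun N => if N = 0 then 1 else if m ∣ N then f m (N / m) else 0

theorem one_add_tsum_eq_partitionFactor {R : Type*} [CommSemiring R] [TopologicalSpace R]
    [T2Space R] (f : ℕ → ℕ → R) (i : ℕ) :
    letI := PowerSeries.WithPiTopology.instTopologicalSpace R
    1 + ∑' j, f (i + 1) (j + 1) • (X : PowerSeries R) ^ ((i + 1) * (j + 1)) =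
      partitionFactor f (i + 1) := by
  open scoped PowerSeries.WithPiTopology in
  ext N
  rw [map_add, (Nat.Partition.summable_genFun_term f i).map_tsum _
    (WithPiTopology.continuous_coeff _ _), partitionFactor, coeff_mk]
  simp only [coeff_smul, coeff_X_pow, coeff_one, smul_eq_mul, mul_ite, mul_one, mul_zero]
  rcases Nat.eq_zero_or_pos N with rfl | hN
  · simp
  · rw [if_neg hN.ne', if_neg hN.ne', zero_add]
    split_ifs with h
    · obtain ⟨c, rfl⟩ := h
      obtain ⟨c, rfl⟩ : ∃ b, c = b + 1 :=
        ⟨c - 1, by have := Nat.pos_of_mul_pos_left hN; omega⟩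
      rw [tsum_eq_single c, if_pos rfl, Nat.mul_div_cancel_left _ (Nat.succ_pos i)]
      intro j hj
      rw [if_neg]
      intro h
      have := Nat.eq_of_mul_eq_mul_left (Nat.succ_pos i) h
      omega
    · rw [tsum_congr (g := fun _ => 0), tsum_zero]
      intro j
      rw [if_neg]
      rintro rfl
      exact h (Dvd.intro _ rfl)

theorem stablyTendsto_prod_partitionFactor {R : Type*} [CommSemiring R] (f : ℕ → ℕ → R) :
    StablyTendsto (fun M => ∏ i : Fin M, partitionFactor f (i + 1)) (Nat.Partition.genFun f) := by
  open scoped PowerSeries.WithPiTopology in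
  -- For the discrete topology on `R`, convergence of the infinite product means that each
  -- coefficient is eventually constant.
  let : TopologicalSpace R := ⊥
  have : DiscreteTopology R := ⟨rfl⟩
  have h := (Nat.Partition.hasProd_genFun f).tendsto_prod_nat
  rw [PowerSeries.WithPiTopology.tendsto_iff_coeff_tendsto] at h
  intro N
  have hN := h N
  rw [nhds_discrete, Filter.tendsto_pure] at hN
  filter_upwards [hN] with M hM
  rw [← hM, Finset.prod_range]
  simp_rw [one_add_tsum_eq_partitionFactor]

/-- The function `lam ↦ ∑_{m_1 > ... > m_n > 0} ∏_j g(m_j, r_{m_j}(lam))`, the `m_j` running over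
the parts of `lam`. -/
def symmetricSum (g : ℕ → ℕ → ℚ) (n : ℕ) (lam : AllPartitions) : ℚ :=
  ∑ s ∈ Finset.powersetCard n lam.2.parts.toFinset, ∏ m ∈ s, g m (mult lam m)

/-- The coefficient of `t ^ n` in a power series over `ℚ[t]`. -/
def coeffMap (n : ℕ) : PowerSeries (Polynomial ℚ) →+ PowerSeries ℚ where
  toFun G := PowerSeries.mk fun N => (coeff N G).coeff n
  map_zero' := by ext; simp
  map_add' G H := by ext; simp

theorem coeff_coeffMap (n N : ℕ) (G : PowerSeries (Polynomial ℚ)) :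
    coeff N (coeffMap n G) = (coeff N G).coeff n := by simp [coeffMap]

theorem StablyTendsto.coeffMap {u : ℕ → PowerSeries (Polynomial ℚ)}
    {L : PowerSeries (Polynomial ℚ)} (h : StablyTendsto u L) (n : ℕ) :
    StablyTendsto (fun M => PartitionMZV.coeffMap n (u M)) (PartitionMZV.coeffMap n L) :=
  fun N => by
    filter_upwards [h N] with M hM
    rw [coeff_coeffMap, coeff_coeffMap, hM]

theorem coeffMap_C_X_pow_mul (n c : ℕ) (H : PowerSeries ℚ) :
    coeffMap n (C (Polynomial.X ^ c) * PowerSeries.map Polynomial.C H) =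
      if n = c then H else 0 := by
  ext N
  rw [coeff_coeffMap, coeff_C_mul, coeff_map, mul_comm, Polynomial.coeff_C_mul,
    Polynomial.coeff_X_pow]
  split_ifs <;> simp

/-- The weights whose generating function is that of the functions `symmetricSum g n`. -/
def tWeight (g : ℕ → ℕ → ℚ) (m j : ℕ) : Polynomial ℚ := 1 + Polynomial.X * Polynomial.C (g m j)

theorem prod_one_add_X_mul_C_coeff {ι : Type*} (s : Finset ι) (a : ι → ℚ) (n : ℕ) :
    (∏ i ∈ s, (1 + Polynomial.X * Polynomial.C (a i))).coeff n =
      ∑ t ∈ Finset.powersetCard n s, ∏ i ∈ t, a i := by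
  classical
  rw [Finset.prod_one_add, Polynomial.finsetSum_coeff, Finset.powersetCard_eq_filter,
    Finset.sum_filter]
  refine Finset.sum_congr rfl fun t _ => ?_
  rw [Finset.prod_mul_distrib, Finset.prod_const, ← map_prod, Polynomial.coeff_mul_C,
    Polynomial.coeff_X_pow, ite_mul, one_mul, zero_mul]
  simp only [eq_comm]

/-- For each partition the weight is `∏ (1 + t g(m, r_m))` over its distinct parts `m`; its
`t^n`-coefficient is an elementary symmetric function. -/
theorem coeffMap_genFun (g : ℕ → ℕ → ℚ) (n : ℕ) :
    coeffMap n (Nat.Partition.genFun (tWeight g)) = partitionSeries (symmetricSum g n) := by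
  ext N
  rw [coeff_coeffMap, Nat.Partition.coeff_genFun, Polynomial.finsetSum_coeff, partitionSeries,
    coeff_mk]
  refine Finset.sum_congr rfl fun p _ => ?_
  rw [Finsupp.prod, Multiset.toFinsupp_support]
  exact prod_one_add_X_mul_C_coeff _ _ _

/-- The hypothesis `h` reads `∑ g(m, r) x^r = H_m(x) / (1 - x)`, so the factor is `(1 + t H_m(q^m))
/ (1 - q^m)`. The condition `g m 0 = 0` matches the constant term `1` that `partitionFactor`
imposes. -/
theorem partitionFactor_tWeight (g : ℕ → ℕ → ℚ) (H : ℕ → PowerSeries ℚ) {m : ℕ} (hm : m ≠ 0)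
    (h : PowerSeries.mk (g m) = PowerSeries.mk 1 * H m) (h0 : g m 0 = 0) :
    partitionFactor (tWeight g) m =
      PowerSeries.map Polynomial.C (expand m hm (PowerSeries.mk 1)) *
        (1 + C Polynomial.X * PowerSeries.map Polynomial.C (expand m hm (H m))) := by
  rw [mul_add, mul_one, mul_left_comm, ← map_mul, ← map_mul, ← h]
  ext N : 1
  rw [partitionFactor, coeff_mk, map_add, coeff_C_mul, coeff_map, coeff_map, coeff_expand,
    coeff_expand, coeff_mk, coeff_mk]
  rcases Nat.eq_zero_or_pos N with rfl | hN
  · simp [h0]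
  · rw [if_neg hN.ne']
    split_ifs <;> simp [tWeight]

/-- The elementary symmetric polynomials in `a 0, ..., a (M - 1)`. -/
def esymmSeries (a : ℕ → PowerSeries ℚ) (n M : ℕ) : PowerSeries ℚ :=
  ∑ t ∈ Finset.powersetCard n (Finset.univ : Finset (Fin M)), ∏ i ∈ t, a i

theorem coeffMap_prod (a P : ℕ → PowerSeries ℚ) (n M : ℕ) :
    coeffMap n (∏ i : Fin M, (PowerSeries.map Polynomial.C (P i) *
        (1 + C Polynomial.X * PowerSeries.map Polynomial.C (a i)))) =
      (∏ i : Fin M, P i) * esymmSeries a n M := by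
  classical
  rw [Finset.prod_mul_distrib, Finset.prod_one_add, Finset.mul_sum, map_sum, esymmSeries,
    Finset.mul_sum, Finset.powersetCard_eq_filter, Finset.sum_filter]
  refine Finset.sum_congr rfl fun t _ => ?_
  rw [Finset.prod_mul_distrib, Finset.prod_const, ← map_prod, ← map_prod, ← map_pow,
    mul_left_comm, ← map_mul, coeffMap_C_X_pow_mul]
  simp only [eq_comm]

theorem stablyTendsto_partitionSeries (g : ℕ → ℕ → ℚ) (H : ℕ → PowerSeries ℚ)
    (h : ∀ m, PowerSeries.mk (g m) = PowerSeries.mk 1 * H m) (h0 : ∀ m, g m 0 = 0) (n : ℕ) :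
    StablyTendsto (fun M => (∏ i : Fin M, expand (i + 1 : ℕ) i.1.succ_ne_zero (PowerSeries.mk 1)) *
        esymmSeries (fun i => expand (i + 1) i.succ_ne_zero (H (i + 1))) n M)
      (partitionSeries (symmetricSum g n)) := by
  have h1 := (stablyTendsto_prod_partitionFactor (tWeight g)).coeffMap n
  rw [coeffMap_genFun] at h1
  convert h1 using 2 with M
  rw [← coeffMap_prod _ fun i => expand (i + 1) i.succ_ne_zero (PowerSeries.mk 1)]
  congr 1
  exact Finset.prod_congr rfl fun i _ =>
    (partitionFactor_tWeight g H i.1.succ_ne_zero (h _) (h0 _)).symm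

/-! ### Newton's identities and the `q`-bracket. -/

theorem mul_esymmSeries (a : ℕ → PowerSeries ℚ) (n M : ℕ) :
    (n : PowerSeries ℚ) * esymmSeries a n M = (-1) ^ (n + 1) *
      ∑ p ∈ Finset.HasAntidiagonal.antidiagonal n with p.1 < n,
        (-1) ^ p.1 * esymmSeries a p.1 M * ∑ i : Fin M, a i ^ p.2 := by
  have h := congrArg (MvPolynomial.aeval fun i : Fin M => a i)
    (MvPolynomial.mul_esymm_eq_sum (Fin M) ℚ n)
  have he : ∀ n, MvPolynomial.aeval (fun i : Fin M => a i) (MvPolynomial.esymm (Fin M) ℚ n) =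
      esymmSeries a n M := fun n => by
    simp [MvPolynomial.esymm, esymmSeries]
  simpa [he, MvPolynomial.psum] using h

/-- Newton's identities for the generating functions of the functions `symmetricSum g n`. -/
theorem mul_partitionSeries (g : ℕ → ℕ → ℚ) (H P : ℕ → PowerSeries ℚ)
    (h : ∀ m, PowerSeries.mk (g m) = PowerSeries.mk 1 * H m) (h0 : ∀ m, g m 0 = 0)
    (hP : ∀ j, 0 < j → StablyTendsto
      (fun M => ∑ i : Fin M, expand (i + 1 : ℕ) i.1.succ_ne_zero (H (i + 1)) ^ j) (P j)) (n : ℕ) :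
    (n : PowerSeries ℚ) * partitionSeries (symmetricSum g n) = (-1) ^ (n + 1) *
      ∑ p ∈ Finset.HasAntidiagonal.antidiagonal n with p.1 < n,
        (-1) ^ p.1 * partitionSeries (symmetricSum g p.1) * P p.2 := by
  have hs := stablyTendsto_partitionSeries g H h h0
  -- Both sides are limits of one sequence: Newton's identity in `M` variables times the truncated
  -- partition product.
  refine ((hs n).const_mul n).unique ?_
  have h1 := (StablyTendsto.sum ((Finset.HasAntidiagonal.antidiagonal n).filter fun p => p.1 < n)
    (u := fun p M => (-1) ^ p.1 * ((∏ i : Fin M,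
      expand (i + 1 : ℕ) i.1.succ_ne_zero (PowerSeries.mk 1)) *
        esymmSeries (fun i => expand (i + 1) i.succ_ne_zero (H (i + 1))) p.1 M) *
        ∑ i : Fin M, expand (i + 1 : ℕ) i.1.succ_ne_zero (H (i + 1)) ^ p.2)
    (L := fun p => (-1) ^ p.1 * partitionSeries (symmetricSum g p.1) * P p.2)
    fun p hp => ((hs p.1).const_mul _).mul (hP p.2 (by
      have := Finset.mem_filter.1 hp
      have h2 := Finset.HasAntidiagonal.mem_antidiagonal.1 this.1
      omega))).const_mul ((-1) ^ (n + 1))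
  convert h1 using 2 with M
  rw [mul_left_comm, mul_esymmSeries, mul_left_comm, Finset.mul_sum]
  congr 1
  exact Finset.sum_congr rfl fun p _ => by ring

theorem constantCoeff_partitionSeries_one :
    constantCoeff (partitionSeries fun _ => 1) ≠ 0 := by
  rw [← coeff_zero_eq_constantCoeff_apply, partitionSeries, coeff_mk]
  simp

/-- Dividing Newton's recursion by the partition generating function and by `n` expresses each
bracket through the earlier ones and the power sums `P j`; the recursion starts from the bracket of
`1`, which is `1`. -/
theorem qBracket_symmetricSum_mem (S : Subalgebra ℚ (PowerSeries ℚ)) (g : ℕ → ℕ → ℚ)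
    (H P : ℕ → PowerSeries ℚ)
    (h : ∀ m, PowerSeries.mk (g m) = PowerSeries.mk 1 * H m) (h0 : ∀ m, g m 0 = 0)
    (hP : ∀ j, 0 < j → StablyTendsto
      (fun M => ∑ i : Fin M, expand (i + 1 : ℕ) i.1.succ_ne_zero (H (i + 1)) ^ j) (P j))
    (hPS : ∀ j, 0 < j → P j ∈ S) (n : ℕ) : qBracket (symmetricSum g n) ∈ S := by
  induction n using Nat.strong_induction_on with
  | _ n ih =>
    rcases Nat.eq_zero_or_pos n with rfl | hn
    · have h1 : symmetricSum g 0 = fun _ => 1 := by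
        funext lam
        simp [symmetricSum]
      rw [h1, qBracket, PowerSeries.mul_inv_cancel _ constantCoeff_partitionSeries_one]
      exact one_mem S
    · have hn' : (n : ℚ) ≠ 0 := by positivity
      have hq : qBracket (symmetricSum g n) = (n : ℚ)⁻¹ • ((-1) ^ (n + 1) *
          ∑ p ∈ Finset.HasAntidiagonal.antidiagonal n with p.1 < n,
            (-1) ^ p.1 * qBracket (symmetricSum g p.1) * P p.2) := by
        have h2 := congrArg (· * (partitionSeries fun _ => 1)⁻¹)
          (mul_partitionSeries g H P h h0 hP n)
        rw [mul_assoc, ← qBracket, mul_assoc, Finset.sum_mul] at h2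
        rw [eq_inv_smul_iff₀ hn', Nat.cast_smul_eq_nsmul, nsmul_eq_mul, h2]
        congr 1
        exact Finset.sum_congr rfl fun p _ => by rw [qBracket]; ring
      rw [hq]
      refine S.smul_mem (mul_mem (pow_mem (neg_mem (one_mem S)) _) (sum_mem fun p hp => ?_)) _
      obtain ⟨hp1, hp2⟩ := Finset.mem_filter.1 hp
      have h2 := Finset.HasAntidiagonal.mem_antidiagonal.1 hp1
      exact mul_mem (mul_mem (pow_mem (neg_mem (one_mem S)) _) (ih _ hp2)) (hPS _ (by omega))

/-- The `m`-th summand is `m^(ej) H^j(q^m)`, which affects the coefficient of `q^N` only if `m`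
divides `N`. For `N > 0` all such `m` are included once `M ≥ N`. -/
theorem stablyTendsto_sum_expand_pow (e j : ℕ) {H : PowerSeries ℚ} (h0 : constantCoeff H = 0)
    (hj : 0 < j) :
    StablyTendsto (fun M => ∑ i : Fin M,
        expand (i + 1 : ℕ) i.1.succ_ne_zero (((i + 1 : ℕ) : ℚ) ^ e • H) ^ j)
      (divisorTransform (e * j) (H ^ j)) := fun N => by
  filter_upwards [Filter.eventually_ge_atTop N] with M hM
  rw [map_sum, coeff_divisorTransform]
  have h1 : ∀ i : Fin M,
      coeff N (expand (i + 1 : ℕ) i.1.succ_ne_zero (((i + 1 : ℕ) : ℚ) ^ e • H) ^ j) =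
      if (i + 1 : ℕ) ∣ N then ((i + 1 : ℕ) : ℚ) ^ (e * j) * coeff (N / (i + 1)) (H ^ j) else 0 := by
    intro i
    rw [← map_pow, smul_pow, expand_smul, coeff_smul, coeff_expand, ← pow_mul, smul_eq_mul,
      mul_ite, mul_zero]
  rw [Finset.sum_congr rfl fun i _ => h1 i]
  rcases Nat.eq_zero_or_pos N with rfl | hN
  -- Every `m` divides `0`, so convergence of the constant terms relies on `H` having none.
  · simp [h0, hj.ne']
  · rw [← Finset.sum_range fun i => if i + 1 ∣ N then
      ((i + 1 : ℕ) : ℚ) ^ (e * j) * coeff (N / (i + 1)) (H ^ j) else 0, ← Finset.sum_filter]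
    refine Finset.sum_nbij' (fun i => i + 1) (fun m => m - 1) ?_ ?_ ?_ ?_ ?_
    · intro i hi
      exact Nat.mem_divisors.2 ⟨(Finset.mem_filter.1 hi).2, hN.ne'⟩
    · intro m hm
      have h2 := Nat.divisor_le hm
      have h3 := Nat.pos_of_mem_divisors hm
      rw [Finset.mem_filter, Finset.mem_range, Nat.sub_add_cancel h3]
      exact ⟨by omega, Nat.dvd_of_mem_divisors hm⟩
    · intro i _
      simp
    · intro m hm
      exact Nat.sub_add_cancel (Nat.pos_of_mem_divisors hm)
    · intro i _
      rfl

/-! ### Application to the Bernoulli–Seki polynomials. -/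

/-- A decreasing sequence is determined by its set of values, and the product is symmetric because
the same `w` is used in every position. -/
theorem finsum_decSeq (w : ℕ → ℚ) (S : Finset ℕ) (hS : ∀ m ∈ S, 0 < m) (hw : ∀ m ∉ S, w m = 0)
    (n : ℕ) : ∑ᶠ m : DecSeq n, ∏ j, w (m.1 j) = ∑ s ∈ Finset.powersetCard n S, ∏ m ∈ s, w m := by
  have h1 : ∑ᶠ m : DecSeq n, ∏ j, w (m.1 j) =
      ∑ᶠ m ∈ {m : DecSeq n | ∀ j, m.1 j ∈ S}, ∏ j, w (m.1 j) := by
    rw [← finsum_mem_univ]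
    refine finsum_mem_inter_support_eq' _ _ _ fun m hm => ?_
    refine ⟨fun _ j => ?_, fun _ => trivial⟩
    by_contra h
    exact hm (Finset.prod_eq_zero (Finset.mem_univ j) (hw _ h))
  rw [h1, ← finsum_mem_coe_finset]
  refine finsum_mem_eq_of_bijOn (fun m => Finset.univ.image m.1) ⟨?_, ?_, ?_⟩ ?_
  · intro m hm
    rw [Finset.mem_coe, Finset.mem_powersetCard, Finset.card_image_of_injective _ m.2.1.injective]
    exact ⟨Finset.image_subset_iff.2 fun j _ => hm j, by simp⟩
  · intro m _ m' _ h
    have h2 : Set.range m.1 = Set.range m'.1 := by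
      have := congrArg (fun s : Finset ℕ => (s : Set ℕ)) h
      simpa using this
    exact Subtype.ext ((m.2.1.range_inj m'.2.1).1 h2)
  · intro s hs
    obtain ⟨hsS, hsn⟩ := Finset.mem_powersetCard.1 hs
    have hmem : ∀ j, s.orderEmbOfFin hsn (Fin.rev j) ∈ S := fun j =>
      hsS (Finset.orderEmbOfFin_mem s hsn _)
    -- The inverse lists a set in increasing order and reverses it.
    refine ⟨⟨fun j => s.orderEmbOfFin hsn (Fin.rev j), fun i j hij =>
      (s.orderEmbOfFin hsn).strictMono (Fin.rev_lt_rev.2 hij), fun j => hS _ (hmem j)⟩, hmem, ?_⟩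
    rw [← Finset.coe_inj, Finset.coe_image, Finset.coe_univ, Set.image_univ,
      ← Finset.range_orderEmbOfFin s hsn]
    exact Fin.rev_surjective.range_comp (s.orderEmbOfFin hsn)
  · intro m _
    rw [Finset.prod_image m.2.1.injective.injOn]

theorem partitionMZV_bernoulliSeki_eq {k d : ℕ} (hk : 1 ≤ k) (n : ℕ) :
    partitionMZV bernoulliSeki (fun _ : Fin n => k) (fun _ : Fin n => d) =
      symmetricSum (fun m j => (m : ℚ) ^ d * (bernoulliSeki k).eval (j : ℚ)) n := by
  funext lam
  refine finsum_decSeq (fun m => (m : ℚ) ^ d * (bernoulliSeki k).eval (mult lam m : ℚ))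
    lam.2.parts.toFinset (fun m hm => lam.2.parts_pos (Multiset.mem_toFinset.1 hm))
    (fun m hm => ?_) n
  rw [mult, Multiset.count_eq_zero.2 fun h => hm (Multiset.mem_toFinset.2 h), Nat.cast_zero,
    bernoulliSeki_eval_zero hk, mul_zero]

theorem bernoulliSeki_eval_natCast {k : ℕ} (hk : 1 ≤ k) (N : ℕ) :
    (bernoulliSeki k).eval (N : ℚ) =
      ∑ r ∈ Finset.Icc 1 N, 1 / ((k - 1).factorial : ℚ) * (r : ℚ) ^ (k - 1) := by
  induction N with
  | zero => simp [bernoulliSeki_eval_zero hk]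
  | succ N ih =>
    have h := bernoulliSeki_sub hk ((N + 1 : ℕ) : ℚ)
    rw [Nat.cast_succ, add_sub_cancel_right, ← Nat.cast_succ] at h
    rw [Finset.sum_Icc_succ_top (by omega), ← ih]
    linarith

theorem partitionMZV_bernoulliSeki_mem {n : ℕ} (k d : Fin n → ℕ) (hk : ∀ j, 1 ≤ k j) :
    partitionMZV bernoulliSeki k d ∈ polynomialFunctions := by
  -- Since `f_k(N)` is the sum of `r^(k-1) / (k-1)!` for `1 ≤ r ≤ N`, a monomial in the `x_j`, `y_j`
  -- with these constants is a preimage under `Ψ`.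
  refine ⟨DirectSum.lof ℚ ℕ (fun n => MvPolynomial (Fin n ⊕ Fin n) ℚ) n
    (∏ j, MvPolynomial.X (Sum.inl j) ^ d j *
      (MvPolynomial.C (1 / ((k j - 1).factorial : ℚ)) *
        MvPolynomial.X (Sum.inr j) ^ (k j - 1))), ?_⟩
  rw [Psi, DirectSum.toModule_lof]
  funext lam
  refine finsum_congr fun m => ?_
  simp only [psiTerm, map_prod, map_mul, map_pow, MvPolynomial.eval_X, MvPolynomial.eval_C,
    Sum.elim_inl, Sum.elim_inr]
  rw [← Finset.prod_univ_sum (fun j => Finset.Icc 1 (mult lam (m.1 j))) fun j r =>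
    (m.1 j : ℚ) ^ d j * (1 / ((k j - 1).factorial : ℚ) * (r : ℚ) ^ (k j - 1))]
  refine Finset.prod_congr rfl fun j _ => ?_
  rw [bernoulliSeki_eval_natCast (hk j), Finset.mul_sum]

/-- Multiplication by `1 - x` takes first differences of coefficients, which the defining equation
of `f_k` evaluates. At `r = 0` the identity needs `0^(k-1) = 0`, hence `k ≥ 2`. -/
theorem mk_bernoulliSeki {k : ℕ} (hk : 2 ≤ k) (c : ℚ) :
    PowerSeries.mk (fun j : ℕ => c * (bernoulliSeki k).eval (j : ℚ)) =
      PowerSeries.mk 1 * (c • (1 / ((k - 1).factorial : ℚ)) • powSeries (k - 1)) := by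
  have key : PowerSeries.mk (fun j : ℕ => c * (bernoulliSeki k).eval (j : ℚ)) * (1 - X) =
      c • (1 / ((k - 1).factorial : ℚ)) • powSeries (k - 1) := by
    ext N
    rw [mul_sub, mul_one, map_sub, coeff_smul, coeff_smul, powSeries, coeff_mk, coeff_mk,
      smul_eq_mul, smul_eq_mul]
    cases N with
    | zero => simp [bernoulliSeki_eval_zero (by omega : 1 ≤ k), show k - 1 ≠ 0 by omega]
    | succ N =>
      have h := bernoulliSeki_sub (by omega : 1 ≤ k) ((N + 1 : ℕ) : ℚ)
      rw [Nat.cast_succ, add_sub_cancel_right] at h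
      rw [coeff_succ_mul_X, coeff_mk, ← mul_sub, Nat.cast_succ, h]
  rw [← key, mul_left_comm, mk_one_mul_one_sub_eq_one, mul_one]

theorem qBracket_partitionMZV_bernoulliSeki_mem {k d : ℕ} (hk : 2 ≤ k) (hkd : Even (k + d))
    (n : ℕ) : qBracket (partitionMZV bernoulliSeki (fun _ : Fin n => k) (fun _ : Fin n => d)) ∈
      eisensteinDerivativeAlgebra := by
  have h0 : constantCoeff ((1 / ((k - 1).factorial : ℚ)) • powSeries (k - 1)) = 0 := by
    rw [← coeff_zero_eq_constantCoeff_apply, coeff_smul, powSeries, coeff_mk]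
    simp [show k - 1 ≠ 0 by omega]
  rw [partitionMZV_bernoulliSeki_eq (by omega)]
  refine qBracket_symmetricSum_mem _ _
    (fun m => (m : ℚ) ^ d • (1 / ((k - 1).factorial : ℚ)) • powSeries (k - 1))
    (fun j => divisorTransform (d * j) (((1 / ((k - 1).factorial : ℚ)) • powSeries (k - 1)) ^ j))
    (fun m => mk_bernoulliSeki hk _)
    (fun m => by rw [Nat.cast_zero, bernoulliSeki_eval_zero (by omega), mul_zero])
    (fun j hj => stablyTendsto_sum_expand_pow d j h0 hj) (fun j hj => ?_) n
  rw [smul_pow, map_smul]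
  refine Subalgebra.smul_mem _ (divisorTransform_powSeries_pow_mem (by omega) hj ?_) _
  have h1 : Odd (k + d - 1) := Nat.Even.sub_odd (by omega) hkd odd_one
  rwa [show k + d - 1 = k - 1 + d by omega] at h1

end PartitionMZV

end

theorem mainTheorem7 (k d n : ℕ) (hk : 2 ≤ k) (hkd : Even (k + d)) :
    (PartitionMZV.partitionMZV PartitionMZV.bernoulliSeki
        (fun _ : Fin n => k) (fun _ : Fin n => d) ∈ PartitionMZV.quasimodularFunctions) ∧
      (PartitionMZV.qBracket
          (PartitionMZV.partitionMZV PartitionMZV.bernoulliSeki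
            (fun _ : Fin n => k) (fun _ : Fin n => d)) ∈
        PartitionMZV.eisensteinDerivativeAlgebra) := by
  have h := PartitionMZV.qBracket_partitionMZV_bernoulliSeki_mem hk hkd n
  exact ⟨⟨PartitionMZV.partitionMZV_bernoulliSeki_mem _ _ fun _ => by omega,
    PartitionMZV.eisensteinDerivativeAlgebra_le h⟩, h⟩
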